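/- Let $\mathcal{M}$ be a von Neumann algebra acting on a complex Hilbert space $\mathcal{H}$, and let $\tau$ be a normal semifinite faithful trace on $\mathcal{M}$. Let $L_0(\mathcal{M},\tau)$ be the $*$-algebra of $\tau$-measurable operators, that is, of the closed densely defined operators $x$ affiliated with $\mathcal{M}$ such that for every $\epsilon>0$ there is a projection $e\in\mathcal{M}$ with $\tau(\mathbf{1}-e)\le\epsilon$ and $xe\in\mathcal{M}$; sums and products in $L_0(\mathcal{M},\tau)$ are the closures of the algebraic ones. Let $L_0(\mathcal{M},\tau)^+$ be the set of those $x\in L_0(\mathcal{M},\tau)$ with $\langle x\xi,\xi\rangle\ge 0$ for all $\xi$ in the domain of $x$. A sequence $(z_n)$ in $L_0(\mathcal{M},\tau)$ converges bilaterally almost uniformly (b.a.u.) to $z\in L_0(\mathcal{M},\tau)$ if for every $\epsilon>0$ there is a projection $e\in\mathcal{M}$ with $\tau(\mathbf{1}-e)\le\epsilon$ and $\|e(z_n-z)e\|_\infty\to 0$ as $n\to\infty$, where $\|\cdot\|_\infty$ is the operator norm on $\mathcal{M}$ (and $\infty$ off $\mathcal{M}$). Let $(x_k)_{k=0}^\infty\subset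 L_0(\mathcal{M},\tau)^+$, and for every real $t\ge 1$ put $$A_t:=\frac1t\sum_{k=0}^{[t]-1}x_k,$$ where $[t]$ is the greatest integer not exceeding $t$. Let $(\rho_j)_{j=0}^\infty\subset(1,\infty)$ be a sequence such that $\rho_j\to 1$ as $j\to\infty$ and $\{\rho_j^m:m\ge 1\}\subseteq\{\rho_\ell^m:m\ge 1\}$ (with $m$ ranging over the positive integers) whenever $j\le\ell$. Assume that for every $j\ge 0$ there exists $y_j\in L_0(\mathcal{M},\tau)^+$ such that $A_{\rho_j^m}\to y_j$ b.a.u. as $m\to\infty$. Then $y_j=y_\ell$ for all $j,\ell\ge 0$, and if $y$ denotes this common limit, then the full sequence $(A_n)_{n=1}^\infty$ converges to $y$ b.a.u. as $n\to\infty$. -/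

import Mathlib

open Filter Topology
open scoped ENNReal NNReal

namespace NCErgodic

variable {H : Type*} [NormedAddCommGroup H] [InnerProductSpace ℂ H] [CompleteSpace H]

/-- `τ` is a normal semifinite faithful trace on the von Neumann algebra `M`. A trace is a function
on the positive cone of `M`; here it is written as a total function on `B(H)`, of which only
the values at positive elements of `M` are ever used. The order is the Loewner order. -/
structure IsNSFTrace (M : VonNeumannAlgebra H) (τ : (H →L[ℂ] H) → ℝ≥0∞) : Prop where
  map_add : ∀ x ∈ M, ∀ y ∈ M, 0 ≤ x → 0 ≤ y → τ (x + y) = τ x + τ y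
  map_smul : ∀ (c : ℝ≥0), ∀ x ∈ M, 0 ≤ x → τ (((c : ℝ) : ℂ) • x) = (c : ℝ≥0∞) * τ x
  /-- The trace property. -/
  map_star_mul_self : ∀ x ∈ M, τ (star x * x) = τ (x * star x)
  /-- Faithfulness. -/
  faithful : ∀ x ∈ M, 0 ≤ x → τ x = 0 → x = 0
  /-- Normality: `τ` preserves suprema of bounded upward directed families. -/
  normal : ∀ S : Set (H →L[ℂ] H), S.Nonempty → (∀ s ∈ S, s ∈ M ∧ 0 ≤ s) →
    DirectedOn (· ≤ ·) S → ∀ x ∈ M, IsLUB S x → τ x = ⨆ s ∈ S, τ s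
  /-- Semifiniteness: below each nonzero positive element there is a nonzero one of finite trace. -/
  semifinite : ∀ x ∈ M, 0 ≤ x → x ≠ 0 → ∃ y ∈ M, 0 ≤ y ∧ y ≤ x ∧ y ≠ 0 ∧ τ y < ∞

/-- `e` is a projection in `M` with `τ(1 - e) ≤ ε`. -/
def IsLargeProj (M : VonNeumannAlgebra H) (τ : (H →L[ℂ] H) → ℝ≥0∞) (ε : ℝ)
    (e : H →L[ℂ] H) : Prop :=
  e ∈ M ∧ IsStarProjection e ∧ τ (1 - e) ≤ ENNReal.ofReal ε

/-- A bounded operator regarded as an everywhere defined unbounded operator. -/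
def ofBounded (z : H →L[ℂ] H) : H →ₗ.[ℂ] H := (z : H →ₗ[ℂ] H).toPMap ⊤

/-- The product `x b` of an unbounded operator `x` and a bounded operator `b`, with its natural
domain `{ξ | b ξ ∈ dom x}`. -/
def mulBounded (x : H →ₗ.[ℂ] H) (b : H →L[ℂ] H) : H →ₗ.[ℂ] H where
  domain := x.domain.comap (b : H →ₗ[ℂ] H)
  toFun := x.toFun ∘ₗ (b : H →ₗ[ℂ] H).submoduleComap x.domain

/-- The product `b x` of a bounded operator `b` and an unbounded operator `x`, with
domain `dom x`. -/
def boundedMul (b : H →L[ℂ] H) (x : H →ₗ.[ℂ] H) : H →ₗ.[ℂ] H := (b : H →ₗ[ℂ] H).compPMap x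

/-- `x` is affiliated with `M`: `y x ⊆ x y` for every `y` in the commutant of `M`. -/
def IsAffiliated (M : VonNeumannAlgebra H) (x : H →ₗ.[ℂ] H) : Prop :=
  ∀ y ∈ M.commutant, boundedMul y x ≤ mulBounded x y

/-- `L₀(M, τ)`: the closed densely defined operators affiliated with `M` that are `τ`-measurable,
i.e. for every `ε > 0` there is a projection `e ∈ M` with `τ(1 - e) ≤ ε` and `x e ∈ M`. -/
def L0 (M : VonNeumannAlgebra H) (τ : (H →L[ℂ] H) → ℝ≥0∞) : Set (H →ₗ.[ℂ] H) :=
  {x | x.IsClosed ∧ Dense (x.domain : Set H) ∧ IsAffiliated M x ∧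
    ∀ ε : ℝ, 0 < ε → ∃ e, IsLargeProj M τ ε e ∧ ∃ z ∈ M, mulBounded x e = ofBounded z}

/-- The positive part of `L₀(M, τ)`: those `x` with `⟨x ξ, ξ⟩ ≥ 0` for all `ξ ∈ dom x`. -/
def L0Pos (M : VonNeumannAlgebra H) (τ : (H →L[ℂ] H) → ℝ≥0∞) : Set (H →ₗ.[ℂ] H) :=
  {x | x ∈ L0 M τ ∧ ∀ ξ : x.domain,
    0 ≤ (inner ℂ (x ξ) (ξ : H)).re ∧ (inner ℂ (x ξ) (ξ : H)).im = 0}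

/-- The difference in `L₀(M, τ)`: the closure of the algebraic difference. -/
noncomputable def closedSub (x y : H →ₗ.[ℂ] H) : H →ₗ.[ℂ] H := (x - y).closure

/-- The product `e x e` in `L₀(M, τ)` for bounded `e`: the closure of the algebraic product. -/
noncomputable def compress (e : H →L[ℂ] H) (x : H →ₗ.[ℂ] H) : H →ₗ.[ℂ] H :=
  (boundedMul e (mulBounded x e)).closure

/-- The norm `‖x‖_∞`: the operator norm if `x` is (everywhere defined, bounded and) an element
of `M`, and `∞` otherwise. -/
noncomputable def normInf (M : VonNeumannAlgebra H) (x : H →ₗ.[ℂ] H) : ℝ≥0∞ :=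
  ⨅ (z : H →L[ℂ] H) (_ : z ∈ M ∧ x = ofBounded z), ‖z‖ₑ

/-- Bilateral almost uniform convergence `u n → y`: for every `ε > 0` there is a projection `e ∈ M`
with `τ(1 - e) ≤ ε` and `‖e (u n - y) e‖_∞ → 0`. -/
def TendstoBAU (M : VonNeumannAlgebra H) (τ : (H →L[ℂ] H) → ℝ≥0∞)
    (u : ℕ → H →ₗ.[ℂ] H) (y : H →ₗ.[ℂ] H) : Prop :=
  ∀ ε : ℝ, 0 < ε → ∃ e, IsLargeProj M τ ε e ∧
    Tendsto (fun n => normInf M (compress e (closedSub (u n) y))) atTop (𝓝 0)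

/-- The average `A_t = (1/t) ∑_{k=0}^{[t]-1} x_k` in `L₀(M, τ)` (for `t ≥ 1`): the closure of the
corresponding linear combination of operators, which is defined on `⋂_{k < [t]} dom x_k`. -/
noncomputable def average (x : ℕ → H →ₗ.[ℂ] H) (t : ℝ) : H →ₗ.[ℂ] H :=
  (((t⁻¹ : ℝ) : ℂ) • ∑ k ∈ Finset.range ⌊t⌋₊, x k).closure

end NCErgodic

/-!
For positive `x_k` the partial sums increase, so for `ρᵐ ≤ n < ρᵐ⁺¹` the average `A_n` lies between
`ρ⁻¹ A_{ρᵐ}` and `ρ A_{ρᵐ⁺¹}`. On a subspace where the limit `y` is bounded by `K`, convergence of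
`A_{ρᵐ}` to `y` puts `A_n` eventually within about `(ρ - 1) K` of `y`, and `ρ` may be taken along
`ρ_j → 1`. All `ρ_j` have the same limit since `ρ_j` is a power of `ρ_l` for `j ≤ l`, so that the
averages along the powers of `ρ_j` are a subsequence of those along the powers of `ρ_l`.

Everything is carried out on the range of one projection `e ∈ M` with `τ(1 - e) ≤ ε` that lies below
countably many given large projections (`HoldsOnLarge.forall`): every `x_k` and `y` is everywhere
defined and bounded there (`BoundedOn`), and the quadratic forms of the averages converge uniformly
(`FormTendsto`). Hence no sum, product or closure of unbounded operators has to be computed: the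
compressions `e (A_n - y) e` are closures of everywhere defined bounded operators, they belong to
`M`, they are self-adjoint, and their norms are read off from their quadratic forms
(`FormTendsto.tendsto_normInf`, `formTendsto_average`).

The infimum of countably many large projections is large because the trace is countably subadditive
on projections (`IsNSFTrace.map_closureProj_iSup_le`). This rests on the comparison of the left and
right supports of an operator, `IsNSFTrace.map_closureProj_range_le`, which is derived from
normality and the trace property without the polar decomposition.

The uniqueness of the limit (`TendstoBAU.unique`) uses that two operators in `L₀⁺` which agree on
the ranges of arbitrarily large projections are equal (`eq_of_holdsOnLarge`): a symmetric operator
has no deficiency on such a range, so the common part of the two operators is a core of each.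
-/

namespace NCErgodic

section Projections

variable {H : Type*} [NormedAddCommGroup H] [InnerProductSpace ℂ H] [CompleteSpace H]

/-! ### Projections onto closed subspaces -/

/-- The orthogonal projection onto the closure of a subspace. -/
noncomputable def closureProj (U : Submodule ℂ H) : H →L[ℂ] H := U.topologicalClosure.starProjection

lemma isStarProjection_closureProj (U : Submodule ℂ H) : IsStarProjection (closureProj U) :=
  isStarProjection_starProjection

lemma closureProj_apply_mem (U : Submodule ℂ H) (v : H) :
    closureProj U v ∈ U.topologicalClosure :=
  Submodule.starProjection_apply_mem _ v

lemma closureProj_eq_self {U : Submodule ℂ H} {v : H} (hv : v ∈ U.topologicalClosure) :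
    closureProj U v = v :=
  Submodule.starProjection_eq_self_iff.2 hv

lemma sub_closureProj_mem_orthogonal (U : Submodule ℂ H) (v : H) : v - closureProj U v ∈ Uᗮ := by
  rw [← U.orthogonal_closure]
  exact Submodule.sub_starProjection_mem_orthogonal v

lemma closureProj_eq_of_mem {U : Submodule ℂ H} {u v : H} (hv : v ∈ U.topologicalClosure)
    (huv : u - v ∈ Uᗮ) : closureProj U u = v :=
  Submodule.eq_starProjection_of_mem_orthogonal hv (by rwa [Submodule.orthogonal_closure])

lemma closureProj_eq_zero {U : Submodule ℂ H} {v : H} (hv : v ∈ Uᗮ) : closureProj U v = 0 :=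
  closureProj_eq_of_mem (zero_mem _) (by simpa using hv)

lemma isStarProjection_apply_apply {e : H →L[ℂ] H} (he : IsStarProjection e) (v : H) :
    e (e v) = e v := congr($(he.isIdempotentElem) v)

lemma isStarProjection_inner {e : H →L[ℂ] H} (he : IsStarProjection e) (v w : H) :
    inner ℂ (e v) w = inner ℂ v (e w) := he.isSelfAdjoint.isSymmetric v w

lemma isStarProjection_norm_le {e : H →L[ℂ] H} (he : IsStarProjection e) : ‖e‖ ≤ 1 := by
  obtain ⟨U, _, rfl⟩ := isStarProjection_iff_eq_starProjection.1 he
  exact U.starProjection_norm_le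

/-- A subspace is invariant under the commutant of `M`, i.e. it is affiliated with `M`. -/
def IsInvariant (M : VonNeumannAlgebra H) (U : Submodule ℂ H) : Prop :=
  ∀ y ∈ M.commutant, ∀ v ∈ U, y v ∈ U

lemma closureProj_mem {M : VonNeumannAlgebra H} {U : Submodule ℂ H} (hU : IsInvariant M U) :
    closureProj U ∈ M := by
  rw [VonNeumannAlgebra.IsStarProjection.mem_iff (isStarProjection_closureProj U)]
  intro y hy v hv
  have hv' : v ∈ U.topologicalClosure := by
    simpa [closureProj, Submodule.range_starProjection] using hv
  have : y v ∈ U.topologicalClosure :=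
    map_mem_closure y.continuous hv' (fun w hw => hU y hy w hw)
  simpa [closureProj, Submodule.range_starProjection] using this

lemma mul_comm_of_mem_commutant {M : VonNeumannAlgebra H} {x y : H →L[ℂ] H} (hx : x ∈ M)
    (hy : y ∈ M.commutant) : x * y = y * x :=
  VonNeumannAlgebra.mem_commutant_iff.1 hy x hx

lemma mem_of_commute {M : VonNeumannAlgebra H} {x : H →L[ℂ] H}
    (h : ∀ y ∈ M.commutant, y * x = x * y) : x ∈ M := by
  rw [← M.commutant_commutant]
  exact VonNeumannAlgebra.mem_commutant_iff.2 h

lemma isInvariant_range {M : VonNeumannAlgebra H} {x : H →L[ℂ] H} (hx : x ∈ M) :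
    IsInvariant M x.range := by
  rintro y hy _ ⟨v, rfl⟩
  exact ⟨y v, congr($(mul_comm_of_mem_commutant hx hy) v)⟩

lemma IsInvariant.orthogonal {M : VonNeumannAlgebra H} {U : Submodule ℂ H} (hU : IsInvariant M U) :
    IsInvariant M Uᗮ := by
  intro y hy v hv w hw
  rw [← ContinuousLinearMap.adjoint_inner_left]
  exact hv _ (hU _ (star_mem hy) w hw)

lemma IsInvariant.iSup {M : VonNeumannAlgebra H} {ι : Sort*} {U : ι → Submodule ℂ H}
    (hU : ∀ i, IsInvariant M (U i)) : IsInvariant M (⨆ i, U i) := by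
  intro y hy
  change (⨆ i, U i) ≤ (⨆ i, U i).comap (y : H →ₗ[ℂ] H)
  exact iSup_le fun i v hv => Submodule.mem_iSup_of_mem i (hU i y hy v hv)

lemma IsInvariant.sup {M : VonNeumannAlgebra H} {U V : Submodule ℂ H}
    (hU : IsInvariant M U) (hV : IsInvariant M V) : IsInvariant M (U ⊔ V) := by
  intro y hy
  change U ⊔ V ≤ (U ⊔ V).comap (y : H →ₗ[ℂ] H)
  exact sup_le (fun v hv => Submodule.mem_sup_left (hU y hy v hv))
    (fun v hv => Submodule.mem_sup_right (hV y hy v hv))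

open scoped ComplexOrder in
lemma isLUB_range_of_tendsto {E : Type*} [NormedAddCommGroup E] [InnerProductSpace ℂ E]
    {f : ℕ → E →L[ℂ] E} {p : E →L[ℂ] E} (hle : ∀ n, f n ≤ p)
    (hlim : ∀ v, Tendsto (fun n => f n v) atTop (𝓝 (p v))) : IsLUB (Set.range f) p := by
  refine ⟨by rintro _ ⟨n, rfl⟩; exact hle n, fun b hb => ?_⟩
  rw [ContinuousLinearMap.le_def, ContinuousLinearMap.isPositive_iff_complex]
  have hb' : ∀ n, (b - f n).IsPositive := fun n => hb ⟨n, rfl⟩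
  intro v
  have hl : Tendsto (fun n => inner ℂ ((b - f n) v) v) atTop (𝓝 (inner ℂ ((b - p) v) v)) :=
    ((tendsto_const_nhds.sub (hlim v)).inner tendsto_const_nhds)
  have hcl : IsClosed {z : ℂ | 0 ≤ z} := isClosed_Ici
  have h0 : 0 ≤ inner ℂ ((b - p) v) v :=
    hcl.mem_of_tendsto hl (Eventually.of_forall fun n => (hb' n).inner_nonneg_left v)
  rw [Complex.nonneg_iff] at h0
  refine ⟨Complex.ext (by simp) ?_, h0.1⟩
  rw [Complex.ofReal_im]
  exact h0.2

/-- The powers of the contraction `1 - x x*` tend strongly to `0` on the range of `x`, because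
`‖x v‖² ≤ ‖v‖² - ‖(1 - x* x) v‖²`. -/
lemma tendsto_one_sub_pow_apply {x : H →L[ℂ] H} (hx : ‖x‖ ≤ 1) (v : H) :
    Tendsto (fun n : ℕ => ((1 - x * star x) ^ n) (x v)) atTop (𝓝 0) := by
  set c := 1 - star x * x with hc
  have hcomm : ∀ n : ℕ, (1 - x * star x) ^ n * x = x * c ^ n := by
    intro n
    induction n with
    | zero => simp
    | succ n ih =>
      rw [pow_succ', mul_assoc, ih, pow_succ', ← mul_assoc, ← mul_assoc]
      congr 1
      rw [hc]; noncomm_ring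
  have hstep : ∀ w : H, ‖x w‖ ^ 2 ≤ ‖w‖ ^ 2 - ‖c w‖ ^ 2 := by
    intro w
    have h1 : ‖star x (x w)‖ ≤ ‖x w‖ := by
      refine (ContinuousLinearMap.le_of_opNorm_le (star x) (c := 1) ?_ _).trans (by simp)
      rwa [norm_star]
    have h2 : (inner ℂ w (star x (x w))).re = ‖x w‖ ^ 2 := by
      rw [ContinuousLinearMap.star_eq_adjoint, ContinuousLinearMap.adjoint_inner_right]
      exact inner_self_eq_norm_sq (𝕜 := ℂ) _
    have h3 := norm_sub_sq (𝕜 := ℂ) w (star x (x w))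
    have h4 : c w = w - star x (x w) := by simp [hc]
    rw [h4, h3]
    change _ ≤ _ - (_ - 2 * (inner ℂ w (star x (x w))).re + _)
    rw [h2]
    nlinarith [norm_nonneg (star x (x w)), norm_nonneg (x w)]
  have hsucc : ∀ n : ℕ, (c ^ (n + 1)) v = c ((c ^ n) v) := by
    intro n; rw [pow_succ']; rfl
  have hanti : Antitone fun n : ℕ => ‖(c ^ n) v‖ ^ 2 := by
    refine antitone_nat_of_succ_le fun n => ?_
    have := hstep ((c ^ n) v)
    rw [hsucc]
    nlinarith [sq_nonneg ‖x ((c ^ n) v)‖]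
  have hlim := tendsto_atTop_ciInf hanti ⟨0, by rintro _ ⟨n, rfl⟩; positivity⟩
  have hdiff := hlim.sub (hlim.comp (tendsto_add_atTop_nat 1))
  rw [sub_self] at hdiff
  have hsq : Tendsto (fun n : ℕ => ‖x ((c ^ n) v)‖ ^ 2) atTop (𝓝 0) := by
    refine squeeze_zero (fun n => by positivity) (fun n => ?_) hdiff
    have := hstep ((c ^ n) v)
    simpa only [Function.comp, hsucc] using this
  rw [tendsto_zero_iff_norm_tendsto_zero]
  have heq : ∀ n : ℕ, ((1 - x * star x) ^ n) (x v) = x ((c ^ n) v) :=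
    fun n => congr($(hcomm n) v)
  simp only [heq]
  simpa using hsq.sqrt

lemma tendsto_apply_closure {E : Type*} [NormedAddCommGroup E] [InnerProductSpace ℂ E]
    {f : ℕ → E →L[ℂ] E} (hf : ∀ n, ‖f n‖ ≤ 1) {U : Submodule ℂ E}
    (hU : ∀ v ∈ U, Tendsto (fun n => f n v) atTop (𝓝 0)) {v : E} (hv : v ∈ U.topologicalClosure) :
    Tendsto (fun n => f n v) atTop (𝓝 0) := by
  rw [Metric.tendsto_atTop]
  intro ε hε
  obtain ⟨w, hw, hwv⟩ := Metric.mem_closure_iff.1 hv (ε / 2) (by positivity)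
  obtain ⟨N, hN⟩ := Metric.tendsto_atTop.1 (hU w hw) (ε / 2) (by positivity)
  refine ⟨N, fun n hn => ?_⟩
  have h1 := hN n hn
  rw [dist_zero_right] at h1 ⊢
  have h2 : ‖f n (v - w)‖ ≤ ‖v - w‖ := by
    simpa using (f n).le_of_opNorm_le (hf n) (v - w)
  rw [dist_eq_norm] at hwv
  have h3 : f n v = f n (v - w) + f n w := by rw [← map_add]; simp
  rw [h3]
  linarith [norm_add_le (f n (v - w)) (f n w)]

/-! ### The trace of supports -/

section Trace

variable {M : VonNeumannAlgebra H} {τ : (H →L[ℂ] H) → ℝ≥0∞}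

lemma IsNSFTrace.map_zero (hτ : IsNSFTrace M τ) : τ 0 = 0 := by
  simpa using hτ.map_smul 0 0 (zero_mem M) le_rfl

lemma IsNSFTrace.mono (hτ : IsNSFTrace M τ) {x y : H →L[ℂ] H} (hx : x ∈ M) (hy : y ∈ M)
    (h0 : 0 ≤ x) (hxy : x ≤ y) : τ x ≤ τ y := by
  have := hτ.map_add x hx (y - x) (sub_mem hy hx) h0 (sub_nonneg.2 hxy)
  rw [add_sub_cancel] at this
  rw [this]
  exact le_self_add

lemma sqrt_mem {a : H →L[ℂ] H} (ha : a ∈ M) : CFC.sqrt a ∈ M := by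
  refine mem_of_commute fun y hy => ?_
  have h : Commute a y := mul_comm_of_mem_commutant ha hy
  exact ((h.cfcₙ_nnreal NNReal.sqrt).eq).symm

/-- For a positive `g` commuting with `x* x`, the trace property gives `τ(x g x*) = τ(x* x g)`:
apply it to `x g^{1/2}`. -/
lemma IsNSFTrace.map_mul_mul_star (hτ : IsNSFTrace M τ) {x g : H →L[ℂ] H} (hx : x ∈ M) (hg : g ∈ M)
    (hg0 : 0 ≤ g) (hcomm : Commute g (star x * x)) : τ (x * g * star x) = τ (star x * x * g) := by
  set b := CFC.sqrt g with hb
  have hbb : b * b = g := CFC.sqrt_mul_sqrt_self g hg0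
  have hbs : star b = b := (IsSelfAdjoint.of_nonneg (CFC.sqrt_nonneg g)).star_eq
  have hbc : b * (star x * x) = star x * x * b := (hcomm.cfcₙ_nnreal NNReal.sqrt).eq
  have := hτ.map_star_mul_self (x * b) (mul_mem hx (sqrt_mem hg))
  rw [star_mul, hbs] at this
  have e1 : b * star x * (x * b) = star x * x * g := by
    calc b * star x * (x * b) = b * (star x * x) * b := by noncomm_ring
      _ = star x * x * g := by rw [hbc, mul_assoc, hbb]
  have e2 : x * b * (b * star x) = x * g * star x := by
    calc x * b * (b * star x) = x * (b * b) * star x := by noncomm_ring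
      _ = _ := by rw [hbb]
  rw [e1, e2] at this
  exact this.symm

/-- The trace of the left support of a contraction `x` is at most the trace of any projection
dominating its right support. The left support is the supremum of
`1 - (1 - x x*)ⁿ = x gₙ x*` with `gₙ = ∑_{k<n} (1 - x* x)ᵏ`, and `τ(x gₙ x*)` equals the trace of
`1 - (1 - x* x)ⁿ`, which lies below the right support. -/
lemma IsNSFTrace.map_closureProj_range_le (hτ : IsNSFTrace M τ) {x s : H →L[ℂ] H} (hx : x ∈ M)
    (hs : s ∈ M) (hsp : IsStarProjection s) (hxs : x * s = x) (hx1 : ‖x‖ ≤ 1) :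
    τ (closureProj x.range) ≤ τ s := by
  set p := closureProj x.range with hp
  have hpp : IsStarProjection p := isStarProjection_closureProj _
  have hpM : p ∈ M := closureProj_mem (isInvariant_range hx)
  have hpx : p * x = x := by
    ext v
    exact closureProj_eq_self (Submodule.le_topologicalClosure _ ⟨v, rfl⟩)
  have hxp : star x * p = star x := by
    simpa [hpp.isSelfAdjoint.star_eq] using congr(star $hpx)
  have hsx : s * star x = star x := by
    simpa [hsp.isSelfAdjoint.star_eq] using congr(star $hxs)
  set a := star x * x with ha
  set c := 1 - a with hc
  set d := 1 - x * star x with hd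
  have hc0 : 0 ≤ c := sub_nonneg.2 <| (CStarAlgebra.norm_le_one_iff_of_nonneg a
    (star_mul_self_nonneg x)).1 (by
      rw [ha, CStarRing.norm_star_mul_self]
      exact mul_le_one₀ hx1 (norm_nonneg _) hx1)
  have hd0 : 0 ≤ d := sub_nonneg.2 <| (CStarAlgebra.norm_le_one_iff_of_nonneg (x * star x)
    (mul_star_self_nonneg x)).1 (by
      rw [CStarRing.norm_self_mul_star]
      exact mul_le_one₀ hx1 (norm_nonneg _) hx1)
  have haM : a ∈ M := mul_mem (star_mem hx) hx
  have hcM : c ∈ M := sub_mem (one_mem M) haM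
  set g : ℕ → H →L[ℂ] H := fun n => ∑ k ∈ Finset.range n, c ^ k with hg
  have hgM : ∀ n, g n ∈ M := fun n => sum_mem fun k _ => pow_mem hcM k
  have hg0 : ∀ n, 0 ≤ g n := fun n => Finset.sum_nonneg fun k _ => CStarAlgebra.pow_nonneg hc0 k
  have hcomm : ∀ n, Commute (g n) a := by
    intro n
    refine Commute.sum_left _ _ _ fun k _ => Commute.pow_left ?_ k
    exact (Commute.one_left a).sub_left (Commute.refl a)
  have hag : ∀ n, a * g n = 1 - c ^ n := by
    intro n
    have := mul_neg_geom_sum c n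
    rwa [show 1 - c = a by rw [hc]; abel] at this
  set f : ℕ → H →L[ℂ] H := fun n => x * g n * star x with hf
  have hf0 : ∀ n, 0 ≤ f n := fun n => star_right_conjugate_nonneg (hg0 n) x
  have hfM : ∀ n, f n ∈ M := fun n => mul_mem (mul_mem hx (hgM n)) (star_mem hx)
  have hxc : ∀ n, x * c ^ n = d ^ n * x := by
    intro n
    induction n with
    | zero => simp
    | succ n ih =>
      rw [pow_succ, ← mul_assoc, ih, pow_succ, mul_assoc, mul_assoc]
      congr 1
      rw [hc, hd, ha]; noncomm_ring
  have hfd : ∀ n, f n = 1 - d ^ n := by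
    intro n
    have h1 : x * g n = (∑ k ∈ Finset.range n, d ^ k) * x := by
      rw [hg, Finset.mul_sum, Finset.sum_mul]
      exact Finset.sum_congr rfl fun k _ => hxc k
    have h2 := geom_sum_mul_neg d n
    rw [show 1 - d = x * star x by rw [hd]; abel] at h2
    rw [hf]
    simp only
    rw [h1, mul_assoc, h2]
  have hmono : Monotone f := by
    refine monotone_nat_of_le_succ fun n => ?_
    rw [← sub_nonneg]
    have : f (n + 1) - f n = x * c ^ n * star x := by
      simp only [hf, hg, Finset.sum_range_succ]; noncomm_ring
    rw [this]
    exact star_right_conjugate_nonneg (CStarAlgebra.pow_nonneg hc0 n) x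
  have hle1 : ∀ n, f n ≤ 1 := fun n => by
    rw [hfd]; exact sub_le_self _ (CStarAlgebra.pow_nonneg hd0 n)
  have hlep : ∀ n, f n ≤ p := by
    intro n
    have h := star_left_conjugate_le_conjugate (hle1 n) p
    rw [hpp.isSelfAdjoint.star_eq, mul_one, hpp.isIdempotentElem.eq] at h
    have h2 : p * f n * p = f n := by
      calc p * f n * p = (p * x) * g n * (star x * p) := by simp only [hf]; noncomm_ring
        _ = f n := by rw [hpx, hxp]
    rwa [h2] at h
  have hdn : ∀ n, ‖d ^ n‖ ≤ 1 := fun n =>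
    (CStarAlgebra.norm_le_one_iff_of_nonneg _ (CStarAlgebra.pow_nonneg hd0 n)).2 (by
      have := hf0 n
      rw [hfd] at this
      exact sub_nonneg.1 this)
  have hlim : ∀ v, Tendsto (fun n => f n v) atTop (𝓝 (p v)) := by
    intro v
    have h1 : ∀ n, f n v = p v - (d ^ n) (p v) := by
      intro n
      have h2 : f n * p = f n := by
        calc f n * p = x * g n * (star x * p) := by simp only [hf]; noncomm_ring
          _ = f n := by rw [hxp]
      calc f n v = (f n * p) v := by rw [h2]
        _ = p v - (d ^ n) (p v) := by rw [hfd]; simp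
    simp only [h1]
    have h3 : Tendsto (fun n => (d ^ n) (p v)) atTop (𝓝 0) := by
      refine tendsto_apply_closure hdn ?_ (closureProj_apply_mem x.range v)
      rintro _ ⟨w, rfl⟩
      exact tendsto_one_sub_pow_apply hx1 w
    simpa using tendsto_const_nhds.sub h3
  have hlub := isLUB_range_of_tendsto hlep hlim
  rw [hτ.normal (Set.range f) (Set.range_nonempty f)
    (by rintro _ ⟨n, rfl⟩; exact ⟨hfM n, hf0 n⟩) hmono.directed_le.directedOn_range p hpM hlub]
  refine iSup₂_le ?_
  rintro _ ⟨n, rfl⟩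
  have ht : τ (f n) = τ (a * g n) := hτ.map_mul_mul_star hx (hgM n) (hg0 n) (hcomm n)
  rw [ht]
  have hag0 : 0 ≤ a * g n := by
    rw [hag, sub_nonneg]
    have := hf0 n
    have hanti := CStarAlgebra.pow_antitone hc0 (sub_le_self _ (star_mul_self_nonneg x) : c ≤ 1)
      (Nat.zero_le n)
    simpa using hanti
  have hag1 : a * g n ≤ 1 := by
    rw [hag]; exact sub_le_self _ (CStarAlgebra.pow_nonneg hc0 n)
  refine hτ.mono (mul_mem haM (hgM n)) hs hag0 ?_
  have h := star_left_conjugate_le_conjugate hag1 s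
  rw [hsp.isSelfAdjoint.star_eq, mul_one, hsp.isIdempotentElem.eq] at h
  have h2 : s * (a * g n) * s = a * g n := by
    have h3 : s * a = a := by rw [ha, ← mul_assoc, hsx]
    have h4 : a * s = a := by rw [ha, mul_assoc, hxs]
    calc s * (a * g n) * s = (s * a) * g n * s := by noncomm_ring
      _ = g n * (a * s) := by rw [h3, ← (hcomm n).eq, mul_assoc]
      _ = a * g n := by rw [h4, (hcomm n).eq]
  rwa [h2] at h

end Trace

/-! ### Subadditivity of the trace on projections -/

section Subadditivity

variable {M : VonNeumannAlgebra H} {τ : (H →L[ℂ] H) → ℝ≥0∞}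

lemma closureProj_nonneg (U : Submodule ℂ H) : 0 ≤ closureProj U :=
  (isStarProjection_closureProj U).nonneg

lemma norm_mul_le_one {e f : H →L[ℂ] H} (he : IsStarProjection e) (hf : IsStarProjection f) :
    ‖e * f‖ ≤ 1 :=
  (norm_mul_le e f).trans
    (mul_le_one₀ (isStarProjection_norm_le he) (norm_nonneg _) (isStarProjection_norm_le hf))

/-- The projection onto `U ⊔ V` exceeds that onto `U` by the left support of `(1 - P_U) P_V`. -/
lemma closureProj_sup (U V : Submodule ℂ H) :
    closureProj (U ⊔ V) =
      closureProj U + closureProj ((1 - closureProj U) * closureProj V).range := by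
  set x := (1 - closureProj U) * closureProj V with hx
  have hxv : ∀ v, x v = closureProj V v - closureProj U (closureProj V v) := fun v => by simp [hx]
  have hUle : U.topologicalClosure ≤ (U ⊔ V).topologicalClosure :=
    Submodule.topologicalClosure_mono le_sup_left
  have hVle : V.topologicalClosure ≤ (U ⊔ V).topologicalClosure :=
    Submodule.topologicalClosure_mono le_sup_right
  have hNle : (x.range).topologicalClosure ≤ (U ⊔ V).topologicalClosure := by
    refine Submodule.topologicalClosure_minimal _ ?_ (Submodule.isClosed_topologicalClosure _)
    rintro _ ⟨v, rfl⟩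
    change x v ∈ _
    rw [hxv]
    exact sub_mem (hVle (closureProj_apply_mem _ _)) (hUle (closureProj_apply_mem _ _))
  have hNU : (x.range).topologicalClosure ≤ Uᗮ := by
    refine Submodule.topologicalClosure_minimal _ ?_ (Submodule.isClosed_orthogonal _)
    rintro _ ⟨v, rfl⟩
    change x v ∈ _
    rw [hxv]
    exact sub_closureProj_mem_orthogonal _ _
  ext v
  refine closureProj_eq_of_mem
    (add_mem (hUle (closureProj_apply_mem _ _)) (hNle (closureProj_apply_mem _ _))) ?_
  set n := closureProj x.range v with hn
  have hnU : n ∈ Uᗮ := hNU (closureProj_apply_mem _ _)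
  change v - (closureProj U v + n) ∈ _
  -- The residual is orthogonal to `U`; hence testing it on `V` amounts to testing it on `ran x`.
  have hU : v - (closureProj U v + n) ∈ Uᗮ := by
    rw [← sub_sub]; exact sub_mem (sub_closureProj_mem_orthogonal _ _) hnU
  have hN : v - (closureProj U v + n) ∈ (x.range)ᗮ := by
    rw [add_comm, ← sub_sub]
    refine sub_mem (sub_closureProj_mem_orthogonal _ _) fun w hw => ?_
    have hw' : w ∈ Uᗮ := hNU (Submodule.le_topologicalClosure _ hw)
    rw [← U.orthogonal_closure] at hw'
    exact inner_eq_zero_symm.1 (hw' _ (closureProj_apply_mem U v))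
  rw [← Submodule.inf_orthogonal]
  refine ⟨hU, fun w hw => ?_⟩
  have h1 := hN (x w) ⟨w, rfl⟩
  rw [hxv, closureProj_eq_self (Submodule.le_topologicalClosure _ hw), inner_sub_left] at h1
  have h2 : inner ℂ (closureProj U w) (v - (closureProj U v + n)) = 0 := by
    rw [← U.orthogonal_closure] at hU
    exact hU _ (closureProj_apply_mem U w)
  rwa [h2, sub_zero] at h1

lemma IsNSFTrace.map_closureProj_sup_le (hτ : IsNSFTrace M τ) {U V : Submodule ℂ H}
    (hU : IsInvariant M U) (hV : IsInvariant M V) :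
    τ (closureProj (U ⊔ V)) ≤ τ (closureProj U) + τ (closureProj V) := by
  have hUM := closureProj_mem hU
  have hVM := closureProj_mem hV
  have hx := mul_mem (sub_mem (one_mem M) hUM) hVM
  rw [closureProj_sup, hτ.map_add _ hUM _ (closureProj_mem (isInvariant_range hx))
    (closureProj_nonneg _) (closureProj_nonneg _)]
  gcongr
  refine hτ.map_closureProj_range_le hx hVM (isStarProjection_closureProj V) ?_
    (norm_mul_le_one (isStarProjection_closureProj U).one_sub (isStarProjection_closureProj V))
  rw [mul_assoc, (isStarProjection_closureProj V).isIdempotentElem.eq]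

lemma closureProj_mono : Monotone (closureProj (H := H)) := fun _ _ h =>
  Submodule.starProjection_le_starProjection_iff.2 (Submodule.topologicalClosure_mono h)

lemma tendsto_closureProj_iSup {U : ℕ → Submodule ℂ H} (hU : Monotone U) (v : H) :
    Tendsto (fun n => closureProj (U n) v) atTop (𝓝 (closureProj (⨆ n, U n) v)) := by
  have h := Submodule.starProjection_tendsto_closure_iSup (fun n => (U n).topologicalClosure)
    (fun _ _ h => Submodule.topologicalClosure_mono (hU h)) v
  have heq : (⨆ n, (U n).topologicalClosure).topologicalClosure =
      (⨆ n, U n).topologicalClosure := by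
    refine le_antisymm (Submodule.topologicalClosure_minimal _ (iSup_le fun n =>
      Submodule.topologicalClosure_mono (le_iSup U n)) (Submodule.isClosed_topologicalClosure _))
      (Submodule.topologicalClosure_mono (iSup_mono fun n => Submodule.le_topologicalClosure _))
  have hproj : closureProj (⨆ n, U n) =
      (⨆ n, (U n).topologicalClosure).topologicalClosure.starProjection :=
    Submodule.starProjection_inj.2 heq.symm
  rw [hproj]
  exact h

/-- Countable subadditivity of the trace on projections, by normality. -/
lemma IsNSFTrace.map_closureProj_iSup_le (hτ : IsNSFTrace M τ) {U : ℕ → Submodule ℂ H}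
    (hU : ∀ n, IsInvariant M (U n)) :
    τ (closureProj (⨆ n, U n)) ≤ ∑' n, τ (closureProj (U n)) := by
  set W : ℕ → Submodule ℂ H := fun n => ⨆ k : Fin n, U k with hW
  have hWmono : Monotone W := fun m n h =>
    iSup_le fun k => le_iSup (fun k : Fin n => U k) (Fin.castLE h k)
  have hWinv : ∀ n, IsInvariant M (W n) := fun n => IsInvariant.iSup fun k => hU k
  have hWU : ⨆ n, W n = ⨆ n, U n :=
    le_antisymm (iSup_le fun n => iSup_le fun k => le_iSup U k)
      (iSup_le fun n => le_iSup_of_le (n + 1)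
        (le_iSup (fun k : Fin (n + 1) => U k) (Fin.last n)))
  have hWle : ∀ n, τ (closureProj (W n)) ≤ ∑ k ∈ Finset.range n, τ (closureProj (U k)) := by
    intro n
    induction n with
    | zero =>
      have : closureProj (W 0) = 0 := by
        ext v
        refine closureProj_eq_zero ?_
        rw [show W 0 = ⊥ from iSup_of_empty _, Submodule.bot_orthogonal_eq_top]
        trivial
      simp [this, hτ.map_zero]
    | succ n ih =>
      have h : W (n + 1) ≤ W n ⊔ U n := by
        refine iSup_le fun k => ?_
        rcases Nat.lt_succ_iff_lt_or_eq.1 k.2 with hk | hk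
        · exact le_sup_of_le_left (le_iSup (fun k : Fin n => U k) ⟨k, hk⟩)
        · rw [hk]; exact le_sup_right
      rw [Finset.sum_range_succ]
      exact ((hτ.mono (closureProj_mem (hWinv _)) (closureProj_mem ((hWinv n).sup (hU n)))
        (closureProj_nonneg _) (closureProj_mono h)).trans
        (hτ.map_closureProj_sup_le (hWinv n) (hU n))).trans (by gcongr)
  rw [← hWU]
  have hlub : IsLUB (Set.range fun n => closureProj (W n)) (closureProj (⨆ n, W n)) :=
    isLUB_range_of_tendsto (fun n => closureProj_mono (le_iSup W n))
      (tendsto_closureProj_iSup hWmono)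
  rw [hτ.normal _ (Set.range_nonempty _)
    (by rintro _ ⟨n, rfl⟩; exact ⟨closureProj_mem (hWinv n), closureProj_nonneg _⟩)
    ((closureProj_mono.comp hWmono).directed_le.directedOn_range) _
    (closureProj_mem (IsInvariant.iSup hWinv)) hlub]
  refine iSup₂_le ?_
  rintro _ ⟨n, rfl⟩
  exact (hWle n).trans (ENNReal.sum_le_tsum _)

/-! ### Properties of large projections -/

/-- There are projections `e ∈ M` with the property `P` and with `τ(1 - e)` as small as desired. -/
def HoldsOnLarge (M : VonNeumannAlgebra H) (τ : (H →L[ℂ] H) → ℝ≥0∞)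
    (P : (H →L[ℂ] H) → Prop) : Prop :=
  ∀ ε : ℝ, 0 < ε → ∃ e, IsLargeProj M τ ε e ∧ P e

/-- The property `P` passes from `e` to every `f ∈ M` whose range lies in that of `e`. -/
def IsHereditary (M : VonNeumannAlgebra H) (P : (H →L[ℂ] H) → Prop) : Prop :=
  ∀ e f, f ∈ M → e * f = f → P e → P f

lemma HoldsOnLarge.mono {P Q : (H →L[ℂ] H) → Prop} (hP : HoldsOnLarge M τ P)
    (h : ∀ e ∈ M, IsStarProjection e → P e → Q e) : HoldsOnLarge M τ Q := fun ε hε =>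
  let ⟨e, he, hPe⟩ := hP ε hε
  ⟨e, he, h e he.1 he.2.1 hPe⟩

lemma exists_isLargeProj_le (hτ : IsNSFTrace M τ) {ε : ℕ → ℝ} {δ : ℝ}
    (hεδ : ∑' n, ENNReal.ofReal (ε n) ≤ ENNReal.ofReal δ) {e : ℕ → H →L[ℂ] H}
    (he : ∀ n, IsLargeProj M τ (ε n) (e n)) :
    ∃ f, IsLargeProj M τ δ f ∧ ∀ n, e n * f = f := by
  set U : ℕ → Submodule ℂ H := fun n => (1 - e n).range with hU
  have hmem : ∀ n, 1 - e n ∈ M := fun n => sub_mem (one_mem M) (he n).1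
  have hUinv : ∀ n, IsInvariant M (U n) := fun n => isInvariant_range (hmem n)
  have hUle : ∀ n, τ (closureProj (U n)) ≤ ENNReal.ofReal (ε n) := fun n =>
    (hτ.map_closureProj_range_le (hmem n) (hmem n) (he n).2.1.one_sub
      (he n).2.1.one_sub.isIdempotentElem.eq
      (isStarProjection_norm_le (he n).2.1.one_sub)).trans (he n).2.2
  refine ⟨1 - closureProj (⨆ n, U n),
    ⟨sub_mem (one_mem M) (closureProj_mem (IsInvariant.iSup hUinv)),
      (isStarProjection_closureProj _).one_sub, ?_⟩, fun n => ?_⟩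
  · rw [sub_sub_cancel]
    exact ((hτ.map_closureProj_iSup_le hUinv).trans (ENNReal.tsum_le_tsum hUle)).trans hεδ
  · ext v
    set w := v - closureProj (⨆ n, U n) v with hw
    have h1 : w ∈ (U n)ᗮ :=
      Submodule.orthogonal_le (le_iSup U n) (sub_closureProj_mem_orthogonal _ _)
    have h2 : (1 - e n) w = 0 := by
      have h3 := h1 _ ⟨(1 - e n) w, rfl⟩
      rw [← inner_self_eq_zero (𝕜 := ℂ), ← isStarProjection_inner (he n).2.1.one_sub]
      exact h3
    have h4 : w - e n w = 0 := by simpa using h2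
    simpa [hw] using (sub_eq_zero.1 h4).symm

/-- Countably many hereditary properties that hold on large projections hold simultaneously on
large projections: take the infimum of projections with `τ(1 - eₙ)` summing to at most `ε`. -/
lemma HoldsOnLarge.forall (hτ : IsNSFTrace M τ) {ι : Type*} [Countable ι]
    {P : ι → (H →L[ℂ] H) → Prop} (hP : ∀ i, HoldsOnLarge M τ (P i))
    (hher : ∀ i, IsHereditary M (P i)) : HoldsOnLarge M τ (fun e => ∀ i, P i e) := by
  intro ε hε
  rcases isEmpty_or_nonempty ι with hι | hι
  · exact ⟨1, ⟨one_mem M, .one _, by simp [hτ.map_zero]⟩, fun i => isEmptyElim i⟩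
  obtain ⟨g, hg⟩ := exists_surjective_nat ι
  choose e he hPe using fun n : ℕ => hP (g n) (ε / 2 / 2 ^ n) (by positivity)
  have hsum : ∑' n : ℕ, ENNReal.ofReal (ε / 2 / 2 ^ n) ≤ ENNReal.ofReal ε := by
    rw [← ENNReal.ofReal_tsum_of_nonneg (fun n => by positivity) (summable_geometric_two' ε),
      tsum_geometric_two']
  obtain ⟨f, hf, hef⟩ := exists_isLargeProj_le hτ hsum he
  refine ⟨f, hf, fun i => ?_⟩
  obtain ⟨n, rfl⟩ := hg i
  exact hher _ _ _ hf.1 (hef n) (hPe n)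

lemma HoldsOnLarge.and (hτ : IsNSFTrace M τ) {P Q : (H →L[ℂ] H) → Prop}
    (hP : HoldsOnLarge M τ P) (hQ : HoldsOnLarge M τ Q) (hherP : IsHereditary M P)
    (hherQ : IsHereditary M Q) : HoldsOnLarge M τ (fun e => P e ∧ Q e) := by
  have := HoldsOnLarge.forall hτ (P := fun b : Bool => if b then P else Q)
    (by rintro (_ | _) <;> simpa) (by rintro (_ | _) <;> simpa)
  exact this.mono fun e _ _ h => ⟨h true, h false⟩

lemma IsHereditary.forall {ι : Type*} {P : ι → (H →L[ℂ] H) → Prop}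
    (h : ∀ i, IsHereditary M (P i)) : IsHereditary M (fun e => ∀ i, P i e) :=
  fun e f hf hef hP i => h i e f hf hef (hP i)

lemma IsHereditary.and {P Q : (H →L[ℂ] H) → Prop}
    (hP : IsHereditary M P) (hQ : IsHereditary M Q) : IsHereditary M (fun e => P e ∧ Q e) :=
  fun e f hf hef h => ⟨hP e f hf hef h.1, hQ e f hf hef h.2⟩

/-- If `p ∧ e = 0` then `τ(p) ≤ τ(1 - e)`; so a projection meeting arbitrarily large projections
trivially is `0`. Here `p` is the projection onto `Gᗮ`. -/
lemma orthogonal_eq_bot (hτ : IsNSFTrace M τ) {G : Submodule ℂ H} (hG : IsInvariant M G)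
    (h : HoldsOnLarge M τ fun e => ∀ v ∈ Gᗮ, e v = v → v = 0) : Gᗮ = ⊥ := by
  set p := closureProj Gᗮ with hp
  have hpp : IsStarProjection p := isStarProjection_closureProj _
  have hpM : p ∈ M := closureProj_mem hG.orthogonal
  have hpmem : ∀ v, p v ∈ Gᗮ := fun v => by
    have := closureProj_apply_mem Gᗮ v
    rwa [(Submodule.isClosed_orthogonal G).submodule_topologicalClosure_eq] at this
  have hp0 : τ p = 0 := by
    refine le_antisymm (ENNReal.le_of_forall_pos_le_add fun ε hε _ => ?_) zero_le
    obtain ⟨e, he, hPe⟩ := h ε hε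
    have he' := he.2.1.one_sub
    have hx : p * (1 - e) ∈ M := mul_mem hpM (sub_mem (one_mem M) he.1)
    have hle := hτ.map_closureProj_range_le hx (sub_mem (one_mem M) he.1) he'
      (by rw [mul_assoc, he'.isIdempotentElem.eq]) (norm_mul_le_one hpp he')
    -- A vector of `Gᗮ` orthogonal to the range of `p (1 - e)` is fixed by `e`, hence `0`.
    have heq : closureProj (p * (1 - e)).range = p := by
      ext v
      have hcl : (p * (1 - e)).range.topologicalClosure ≤ Gᗮ := by
        refine Submodule.topologicalClosure_minimal _ ?_ (Submodule.isClosed_orthogonal _)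
        rintro _ ⟨w, rfl⟩
        exact hpmem _
      set u := p v - closureProj (p * (1 - e)).range (p v) with hu
      have huG : u ∈ Gᗮ := sub_mem (hpmem v) (hcl (closureProj_apply_mem _ _))
      have hpu : p u = u := closureProj_eq_self (Submodule.le_topologicalClosure _ huG)
      have hu0 : u = 0 := by
        refine hPe u huG ?_
        have h1 := sub_closureProj_mem_orthogonal (p * (1 - e)).range (p v) _ ⟨(1 - e) u, rfl⟩
        change inner ℂ (p ((1 - e) ((1 - e) u))) u = 0 at h1
        rw [isStarProjection_inner hpp, hpu, isStarProjection_inner he', inner_self_eq_zero] at h1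
        have h2 : u - e u = 0 := by simpa using h1
        exact (sub_eq_zero.1 h2).symm
      have hv : v - p v ∈ ((p * (1 - e)).range)ᗮ := by
        rintro _ ⟨w, rfl⟩
        exact sub_closureProj_mem_orthogonal Gᗮ v _ (hpmem _)
      refine closureProj_eq_of_mem ?_ hv
      rw [sub_eq_zero.1 hu0]
      exact closureProj_apply_mem _ _
    rw [heq] at hle
    rw [zero_add]
    exact hle.trans (by simpa using he.2.2)
  have hpz : p = 0 := hτ.faithful p hpM hpp.nonneg hp0
  rw [Submodule.eq_bot_iff]
  intro v hv
  rw [← closureProj_eq_self (Submodule.le_topologicalClosure _ hv)]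
  change p v = 0
  rw [hpz]; rfl

end Subadditivity

end Projections

/-! ### Graphs of unbounded operators -/

section Graph

variable {H : Type*} [NormedAddCommGroup H] [InnerProductSpace ℂ H]

lemma add_mem_graph {x y : H →ₗ.[ℂ] H} {η v w : H} (hv : (η, v) ∈ x.graph)
    (hw : (η, w) ∈ y.graph) : (η, v + w) ∈ (x + y).graph := by
  rw [LinearPMap.mem_graph_iff] at *
  obtain ⟨a, ha, rfl⟩ := hv
  obtain ⟨b, hb, rfl⟩ := hw
  simp only at ha hb
  subst ha
  exact ⟨⟨a, a.2, by rw [← hb]; exact b.2⟩, rfl, by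
    rw [LinearPMap.add_apply]; congr 2; exact Subtype.ext hb.symm⟩

lemma sub_mem_graph {x y : H →ₗ.[ℂ] H} {η v w : H} (hv : (η, v) ∈ x.graph)
    (hw : (η, w) ∈ y.graph) : (η, v - w) ∈ (x - y).graph := by
  rw [LinearPMap.mem_graph_iff] at *
  obtain ⟨a, ha, rfl⟩ := hv
  obtain ⟨b, hb, rfl⟩ := hw
  simp only at ha hb
  subst ha
  exact ⟨⟨a, a.2, by rw [← hb]; exact b.2⟩, rfl, by
    rw [LinearPMap.sub_apply]; congr 2; exact Subtype.ext hb.symm⟩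

lemma smul_mem_graph {x : H →ₗ.[ℂ] H} {η v : H} (c : ℂ) (hv : (η, v) ∈ x.graph) :
    (η, c • v) ∈ (c • x).graph := by
  rw [LinearPMap.mem_graph_iff] at *
  obtain ⟨a, ha, rfl⟩ := hv
  exact ⟨a, ha, rfl⟩

lemma sum_mem_graph {x : ℕ → H →ₗ.[ℂ] H} {η : H} {v : ℕ → H} (n : ℕ)
    (h : ∀ k < n, (η, v k) ∈ (x k).graph) :
    (η, ∑ k ∈ Finset.range n, v k) ∈ (∑ k ∈ Finset.range n, x k).graph := by
  induction n with
  | zero => exact (LinearPMap.mem_graph_iff _).2 ⟨⟨η, trivial⟩, rfl, rfl⟩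
  | succ n ih =>
    rw [Finset.sum_range_succ, Finset.sum_range_succ]
    exact add_mem_graph (ih fun k hk => h k (hk.trans n.lt_succ_self)) (h n n.lt_succ_self)

lemma mem_graph_closure {x : H →ₗ.[ℂ] H} {a : H × H} (h : a ∈ x.graph) : a ∈ x.closure.graph :=
  LinearPMap.le_graph_of_le x.le_closure h

lemma mem_graph_average {x : ℕ → H →ₗ.[ℂ] H} {η : H} {v : ℕ → H} (t : ℝ)
    (h : ∀ k, (η, v k) ∈ (x k).graph) :
    (η, ((t⁻¹ : ℝ) : ℂ) • ∑ k ∈ Finset.range ⌊t⌋₊, v k) ∈ (average x t).graph :=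
  mem_graph_closure (smul_mem_graph _ (sum_mem_graph _ fun k _ => h k))

lemma mem_graph_closedSub {x y : H →ₗ.[ℂ] H} {η v w : H} (hv : (η, v) ∈ x.graph)
    (hw : (η, w) ∈ y.graph) : (η, v - w) ∈ (closedSub x y).graph :=
  mem_graph_closure (sub_mem_graph hv hw)

lemma mem_graph_boundedMul {x : H →ₗ.[ℂ] H} {η v : H} (b : H →L[ℂ] H) (h : (η, v) ∈ x.graph) :
    (η, b v) ∈ (boundedMul b x).graph := by
  rw [LinearPMap.mem_graph_iff] at *
  obtain ⟨a, ha, rfl⟩ := h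
  exact ⟨a, ha, rfl⟩

lemma mem_graph_mulBounded {x : H →ₗ.[ℂ] H} {η v : H} (b : H →L[ℂ] H) :
    (η, v) ∈ (mulBounded x b).graph ↔ (b η, v) ∈ x.graph := by
  rw [LinearPMap.mem_graph_iff, LinearPMap.mem_graph_iff]
  constructor
  · rintro ⟨a, rfl, rfl⟩
    exact ⟨⟨b a, a.2⟩, rfl, rfl⟩
  · rintro ⟨a, ha, rfl⟩
    simp only at ha
    refine ⟨⟨η, ?_⟩, rfl, ?_⟩
    · change b η ∈ x.domain
      rw [← ha]; exact a.2
    · change x ⟨b η, _⟩ = x a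
      congr 1
      exact Subtype.ext ha.symm

lemma mem_graph_ofBounded {z : H →L[ℂ] H} {a : H × H} :
    a ∈ (ofBounded z).graph ↔ z a.1 = a.2 := by
  rw [LinearPMap.mem_graph_iff]
  constructor
  · rintro ⟨b, hb, hb'⟩
    rw [← hb, ← hb']; rfl
  · intro h
    exact ⟨⟨a.1, trivial⟩, rfl, h⟩

lemma ofBounded_closure (z : H →L[ℂ] H) : (ofBounded z).closure = ofBounded z := by
  have hcl : (ofBounded z).IsClosed := by
    have : ((ofBounded z).graph : Set (H × H)) = {a | z a.1 = a.2} := by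
      ext a; exact mem_graph_ofBounded
    rw [LinearPMap.IsClosed, this]
    exact isClosed_eq (z.continuous.comp continuous_fst) continuous_snd
  refine LinearPMap.eq_of_eq_graph ?_
  rw [← hcl.isClosable.graph_closure_eq_closure_graph]
  exact hcl.submodule_topologicalClosure_eq

lemma eq_ofBounded {x : H →ₗ.[ℂ] H} {z : H →L[ℂ] H} (h : ∀ ξ, (ξ, z ξ) ∈ x.graph) :
    x = ofBounded z := by
  refine (LinearPMap.eq_of_le_of_domain_eq (LinearPMap.le_of_le_graph fun a ha => ?_) ?_).symm
  · have := mem_graph_ofBounded.1 ha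
    have h' := h a.1
    rwa [this] at h'
  · refine le_antisymm (fun ξ _ => LinearPMap.mem_domain_of_mem_graph (h ξ)) le_top

lemma mem_graph_compress {x : H →ₗ.[ℂ] H} {e : H →L[ℂ] H} {ξ v : H} (h : (e ξ, v) ∈ x.graph) :
    (ξ, e v) ∈ (compress e x).graph :=
  mem_graph_closure (mem_graph_boundedMul e ((mem_graph_mulBounded e).2 h))

lemma compress_eq_ofBounded {x : H →ₗ.[ℂ] H} {e z : H →L[ℂ] H}
    (h : ∀ ξ, (e ξ, z ξ) ∈ x.graph) : compress e x = ofBounded (e * z) := by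
  rw [compress, ← ofBounded_closure]
  congr 1
  exact eq_ofBounded fun ξ => mem_graph_boundedMul e ((mem_graph_mulBounded e).2 (h ξ))

/-! ### Bilateral almost uniform convergence through quadratic forms -/

variable [CompleteSpace H]

/-- The operator `x` is everywhere defined on the range of `e`, and `x e` is an element of `M`. -/
def BoundedOn (M : VonNeumannAlgebra H) (x : H →ₗ.[ℂ] H) (e : H →L[ℂ] H) : Prop :=
  ∃ z ∈ M, ∀ ξ, (e ξ, z ξ) ∈ x.graph

/-- On the range of `e`, the quadratic forms of `u n` tend to that of `y` uniformly on the unit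
ball. The operators are given by their graphs, so nothing is asked outside the domains. -/
def FormTendsto (u : ℕ → H →ₗ.[ℂ] H) (y : H →ₗ.[ℂ] H) (e : H →L[ℂ] H) : Prop :=
  ∀ δ : ℝ, 0 < δ → ∀ᶠ n in atTop, ∀ η, e η = η → ∀ v w, (η, v) ∈ (u n).graph →
    (η, w) ∈ y.graph → ‖inner ℂ (v - w) η‖ ≤ δ * ‖η‖ ^ 2

variable {M : VonNeumannAlgebra H} {τ : (H →L[ℂ] H) → ℝ≥0∞}

lemma isHereditary_boundedOn (x : H →ₗ.[ℂ] H) : IsHereditary M (BoundedOn M x) := by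
  rintro e f hf hef ⟨z, hz, h⟩
  refine ⟨z * f, mul_mem hz hf, fun ξ => ?_⟩
  have := h (f ξ)
  rwa [show e (f ξ) = f ξ from congr($hef ξ)] at this

lemma isHereditary_formTendsto (u : ℕ → H →ₗ.[ℂ] H) (y : H →ₗ.[ℂ] H) :
    IsHereditary M (FormTendsto u y) := by
  intro e f hf hef h δ hδ
  filter_upwards [h δ hδ] with n hn η hη
  refine hn η ?_
  conv_lhs => rw [← hη]
  exact (congr($hef η) : e (f η) = f η).trans hη

lemma holdsOnLarge_boundedOn {x : H →ₗ.[ℂ] H} (hx : x ∈ L0 M τ) :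
    HoldsOnLarge M τ (BoundedOn M x) := by
  intro ε hε
  obtain ⟨e, he, z, hz, h⟩ := hx.2.2.2 ε hε
  refine ⟨e, he, z, hz, fun ξ => ?_⟩
  rw [← mem_graph_mulBounded, h]
  exact mem_graph_ofBounded.2 rfl

lemma TendstoBAU.holdsOnLarge {u : ℕ → H →ₗ.[ℂ] H} {y : H →ₗ.[ℂ] H}
    (h : TendstoBAU M τ u y) : HoldsOnLarge M τ (FormTendsto u y) := by
  intro ε hε
  obtain ⟨e, he, hlim⟩ := h ε hε
  refine ⟨e, he, fun δ hδ => ?_⟩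
  filter_upwards [(tendsto_order.1 hlim).2 (ENNReal.ofReal δ) (by simpa using hδ)]
    with n hn η hη v w hv hw
  simp only [normInf, iInf_lt_iff] at hn
  obtain ⟨z, ⟨-, hz⟩, hzn⟩ := hn
  have hzδ : ‖z‖ ≤ δ := by
    rw [← ofReal_norm, ENNReal.ofReal_lt_ofReal_iff hδ] at hzn
    exact hzn.le
  have hmem : (η, e (v - w)) ∈ (compress e (closedSub (u n) y)).graph :=
    mem_graph_compress (by rw [hη]; exact mem_graph_closedSub hv hw)
  rw [hz] at hmem
  have hzη : z η = e (v - w) := mem_graph_ofBounded.1 hmem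
  have hin : inner ℂ (v - w) η = inner ℂ (z η) η := by
    rw [hzη, isStarProjection_inner he.2.1, hη]
  rw [hin]
  calc ‖inner ℂ (z η) η‖ ≤ ‖z η‖ * ‖η‖ := norm_inner_le_norm _ _
    _ ≤ δ * ‖η‖ * ‖η‖ := by gcongr; exact z.le_of_opNorm_le hzδ η
    _ = δ * ‖η‖ ^ 2 := by ring

lemma norm_le_of_symmetric_of_form_le {E : Type*} [NormedAddCommGroup E] [InnerProductSpace ℂ E]
    {z : E →L[ℂ] E} {δ : ℝ} (hδ : 0 ≤ δ)
    (him : ∀ ξ, (inner ℂ (z ξ) ξ).im = 0) (h : ∀ ξ, ‖inner ℂ (z ξ) ξ‖ ≤ δ * ‖ξ‖ ^ 2) :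
    ‖z‖ ≤ δ := by
  have hsymm : (z : E →ₗ[ℂ] E).IsSymmetric := by
    rw [LinearMap.isSymmetric_iff_inner_map_self_real]
    intro ξ
    exact Complex.conj_eq_iff_im.2 (him ξ)
  rw [z.norm_eq_iSup_rayleighQuotient hsymm]
  refine ciSup_le fun ξ => ?_
  rcases eq_or_ne ξ 0 with rfl | hξ
  · simpa using hδ
  rw [ContinuousLinearMap.rayleighQuotient, abs_div, abs_of_nonneg (sq_nonneg ‖ξ‖),
    div_le_iff₀ (by positivity)]
  exact (Complex.abs_re_le_norm _).trans (h ξ)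

/-- For operators bounded on the range of `e`, with real quadratic forms there, convergence of the
quadratic forms gives norm convergence of the compressions. -/
lemma FormTendsto.tendsto_normInf {u : ℕ → H →ₗ.[ℂ] H} {y : H →ₗ.[ℂ] H} {e : H →L[ℂ] H}
    (h : FormTendsto u y e) (heM : e ∈ M) (he : IsStarProjection e) {X : ℕ → H →L[ℂ] H}
    {Y : H →L[ℂ] H} (hXM : ∀ n, X n ∈ M) (hYM : Y ∈ M)
    (hX : ∀ n ξ, (e ξ, X n ξ) ∈ (u n).graph) (hY : ∀ ξ, (e ξ, Y ξ) ∈ y.graph)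
    (hXim : ∀ n ξ, (inner ℂ (X n ξ) (e ξ)).im = 0) (hYim : ∀ ξ, (inner ℂ (Y ξ) (e ξ)).im = 0) :
    Tendsto (fun n => normInf M (compress e (closedSub (u n) y))) atTop (𝓝 0) := by
  rw [ENNReal.tendsto_nhds_zero]
  intro ε hε
  obtain ⟨δ, hδ0, hδε⟩ : ∃ δ : ℝ, 0 < δ ∧ ENNReal.ofReal δ ≤ ε := by
    obtain ⟨r, hr0, hr⟩ := ENNReal.lt_iff_exists_nnreal_btwn.1 hε
    exact ⟨r, by simpa using hr0, by simpa using hr.le⟩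
  filter_upwards [h δ hδ0] with n hn
  have hz : compress e (closedSub (u n) y) = ofBounded (e * (X n - Y)) :=
    compress_eq_ofBounded fun ξ => mem_graph_closedSub (hX n ξ) (hY ξ)
  have hin : ∀ ξ, inner ℂ ((e * (X n - Y)) ξ) ξ = inner ℂ (X n ξ - Y ξ) (e ξ) := fun ξ =>
    isStarProjection_inner he _ _
  have hnorm : ‖e * (X n - Y)‖ ≤ δ := by
    refine norm_le_of_symmetric_of_form_le hδ0.le (fun ξ => ?_) fun ξ => ?_
    · rw [hin, inner_sub_left, Complex.sub_im, hXim, hYim, sub_zero]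
    · rw [hin]
      refine (hn (e ξ) (isStarProjection_apply_apply he ξ) _ _ (hX n ξ) (hY ξ)).trans ?_
      gcongr
      simpa using e.le_of_opNorm_le (isStarProjection_norm_le he) ξ
  refine le_trans (iInf₂_le (e * (X n - Y)) ⟨mul_mem heM (sub_mem (hXM n) hYM), hz⟩) ?_
  refine le_trans ?_ hδε
  rw [← ofReal_norm]
  exact ENNReal.ofReal_le_ofReal hnorm

lemma L0Pos.inner_graph {x : H →ₗ.[ℂ] H} (hx : x ∈ L0Pos M τ) {η v : H} (h : (η, v) ∈ x.graph) :
    0 ≤ (inner ℂ v η).re ∧ (inner ℂ v η).im = 0 := by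
  obtain ⟨a, ha, hv⟩ := (LinearPMap.mem_graph_iff _).1 h
  simp only at ha hv
  rw [← ha, ← hv]
  exact hx.2 a

end Graph

section Uniqueness

variable {H : Type*} [NormedAddCommGroup H] [InnerProductSpace ℂ H] [CompleteSpace H]
  {M : VonNeumannAlgebra H} {τ : (H →L[ℂ] H) → ℝ≥0∞}

/-! ### Uniqueness of the limit -/

lemma IsAffiliated.map_mem_graph {x : H →ₗ.[ℂ] H} (hx : IsAffiliated M x) {c : H →L[ℂ] H}
    (hc : c ∈ M.commutant) {η v : H} (h : (η, v) ∈ x.graph) : (c η, c v) ∈ x.graph :=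
  (mem_graph_mulBounded c).1 (LinearPMap.le_graph_of_le (hx c hc) (mem_graph_boundedMul c h))

/-- If the graphs of `y` and `y'` meet in enough points, then `(y + i)` maps their common part onto
a dense subspace: its orthogonal complement meets large projections trivially because `y` is
symmetric. As `‖(y + i) ζ‖² = ‖y ζ‖² + ‖ζ‖²`, the common part is a core of `y`. -/
lemma graph_le_of_holdsOnLarge (hτ : IsNSFTrace M τ) {y y' : H →ₗ.[ℂ] H} (hy : y ∈ L0Pos M τ)
    (hy' : y' ∈ L0Pos M τ)
    (h : HoldsOnLarge M τ fun e => ∀ η, e η = η → ∃ v, (η, v) ∈ y.graph ∧ (η, v) ∈ y'.graph) :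
    y.graph ≤ y'.graph := by
  set T : H × H →ₗ[ℂ] H := LinearMap.snd ℂ H H + Complex.I • LinearMap.fst ℂ H H with hT
  have hTa : ∀ a, T a = a.2 + Complex.I • a.1 := fun a => rfl
  set G : Submodule ℂ H := (y.graph ⊓ y'.graph).map T with hG
  have hGinv : IsInvariant M G := by
    rintro c hc _ ⟨a, ⟨ha, ha'⟩, rfl⟩
    refine ⟨(c a.1, c a.2), ⟨hy.1.2.2.1.map_mem_graph hc ha, hy'.1.2.2.1.map_mem_graph hc ha'⟩, ?_⟩
    simp [hTa]
  have hGbot : Gᗮ = ⊥ := by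
    refine orthogonal_eq_bot hτ hGinv (h.mono fun e _ _ he w hw hew => ?_)
    obtain ⟨v, hv, hv'⟩ := he w hew
    have h0 := hw _ ⟨(w, v), ⟨hv, hv'⟩, rfl⟩
    rw [hTa, inner_add_left, inner_smul_left] at h0
    have him := congr($(h0).im)
    have hself : inner ℂ w w = ((‖w‖ ^ 2 : ℝ) : ℂ) := by
      rw [inner_self_eq_norm_sq_to_K]; norm_cast
    rw [hself, Complex.add_im, (L0Pos.inner_graph hy hv).2] at him
    simpa [-Complex.ofReal_pow, -map_pow] using him
  have hdense : G.topologicalClosure = ⊤ := Submodule.topologicalClosure_eq_top_iff.2 hGbot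
  have hnorm : ∀ a ∈ y.graph, ‖a‖ ≤ ‖T a‖ := by
    rintro ⟨η, v⟩ ha
    have h1 : ‖v + Complex.I • η‖ ^ 2 = ‖v‖ ^ 2 + ‖η‖ ^ 2 := by
      have h2 := norm_add_sq (𝕜 := ℂ) v (Complex.I • η)
      rw [h2, inner_smul_right, norm_smul, Complex.norm_I, one_mul]
      have h3 : RCLike.re (Complex.I * inner ℂ v η) = 0 := by
        change (Complex.I * inner ℂ v η).re = 0
        simp [(L0Pos.inner_graph hy ha).2]
      rw [h3]; ring
    rw [hTa, Prod.norm_def]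
    exact max_le (abs_le_of_sq_le_sq' (by simp only; nlinarith [sq_nonneg ‖v‖]) (norm_nonneg _)).2
      (abs_le_of_sq_le_sq' (by simp only; nlinarith [sq_nonneg ‖η‖]) (norm_nonneg _)).2
  intro a ha
  have hcl : _root_.IsClosed (y'.graph : Set (H × H)) := hy'.1.1
  rw [← SetLike.mem_coe, ← hcl.closure_eq, Metric.mem_closure_iff]
  intro ε hε
  have hTa' : T a ∈ G.topologicalClosure := by rw [hdense]; trivial
  obtain ⟨_, ⟨b, ⟨hb, hb'⟩, rfl⟩, hab⟩ := Metric.mem_closure_iff.1 hTa' ε hε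
  refine ⟨b, hb', ?_⟩
  rw [dist_eq_norm] at hab ⊢
  rw [← map_sub] at hab
  exact (hnorm _ (sub_mem ha hb)).trans_lt hab

lemma eq_of_holdsOnLarge (hτ : IsNSFTrace M τ) {y y' : H →ₗ.[ℂ] H} (hy : y ∈ L0Pos M τ)
    (hy' : y' ∈ L0Pos M τ)
    (h : HoldsOnLarge M τ fun e => ∀ η, e η = η → ∃ v, (η, v) ∈ y.graph ∧ (η, v) ∈ y'.graph) :
    y = y' :=
  LinearPMap.eq_of_eq_graph (le_antisymm (graph_le_of_holdsOnLarge hτ hy hy' h)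
    (graph_le_of_holdsOnLarge hτ hy' hy (h.mono fun _ _ _ he η hη =>
      let ⟨v, hv, hv'⟩ := he η hη
      ⟨v, hv', hv⟩)))

/-- Projections `eₙ ∈ M` with `τ(1 - eₙ) ≤ 1 / (n + 1)` have no common kernel. -/
lemma eq_zero_of_forall_apply_eq_zero (hτ : IsNSFTrace M τ) {e : ℕ → H →L[ℂ] H}
    (he : ∀ n : ℕ, IsLargeProj M τ (1 / ((n : ℝ) + 1)) (e n)) {u : H} (hu : ∀ n, e n u = 0) :
    u = 0 := by
  have hbot : (⨆ n, (e n).range)ᗮ = ⊥ := by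
    refine orthogonal_eq_bot hτ (IsInvariant.iSup fun n => isInvariant_range (he n).1)
      fun ε hε => ?_
    obtain ⟨n, hn⟩ := exists_nat_one_div_lt hε
    refine ⟨e n, ⟨(he n).1, (he n).2.1, (he n).2.2.trans (ENNReal.ofReal_le_ofReal hn.le)⟩,
      fun v hv hev => ?_⟩
    have hmem : v ∈ ⨆ n, (e n).range := Submodule.mem_iSup_of_mem n ⟨v, hev⟩
    exact inner_self_eq_zero.1 (hv v hmem)
  rw [← Submodule.mem_bot ℂ, ← hbot, ← Submodule.iInf_orthogonal, Submodule.mem_iInf]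
  rintro n _ ⟨v, rfl⟩
  change inner ℂ (e n v) u = 0
  rw [isStarProjection_inner (he n).2.1, hu, inner_zero_right]

/-- Two limits in the sense of quadratic forms have the same compression to the range of `e`: the
form of `e (y - y') e` vanishes, hence so does the operator, by polarization. -/
lemma FormTendsto.apply_sub_eq_zero {u : ℕ → H →ₗ.[ℂ] H} {y y' : H →ₗ.[ℂ] H} {e : H →L[ℂ] H}
    (he : IsStarProjection e) (hu : ∀ n, BoundedOn M (u n) e) (hy : BoundedOn M y e)
    (hy' : BoundedOn M y' e) (h : FormTendsto u y e) (h' : FormTendsto u y' e) {η w w' : H}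
    (hη : e η = η) (hw : (η, w) ∈ y.graph) (hw' : (η, w') ∈ y'.graph) : e (w - w') = 0 := by
  obtain ⟨Y, -, hY⟩ := hy
  obtain ⟨Y', -, hY'⟩ := hy'
  have hform : ∀ ζ, inner ℂ ((e * (Y - Y')) ζ) ζ = 0 := by
    intro ζ
    change inner ℂ (e (Y ζ - Y' ζ)) ζ = 0
    rw [isStarProjection_inner he, ← norm_le_zero_iff]
    have hee := isStarProjection_apply_apply he ζ
    refine le_of_forall_pos_le_add fun ε hε => ?_
    set N := ‖e ζ‖ ^ 2 with hN
    have hN0 : 0 ≤ N := sq_nonneg _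
    have hδ : 0 < ε / (2 * (N + 1)) := by positivity
    obtain ⟨n, hn, hn'⟩ := ((h _ hδ).and (h' _ hδ)).exists
    obtain ⟨X, -, hX⟩ := hu n
    have h1 := hn (e ζ) hee _ _ (hX ζ) (hY ζ)
    have h2 := hn' (e ζ) hee _ _ (hX ζ) (hY' ζ)
    have h3 : inner ℂ (Y ζ - Y' ζ) (e ζ) =
        inner ℂ (X ζ - Y' ζ) (e ζ) - inner ℂ (X ζ - Y ζ) (e ζ) := by
      rw [← inner_sub_left]; congr 1; abel
    rw [h3, zero_add]
    refine (norm_sub_le _ _).trans ((add_le_add h2 h1).trans ?_)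
    rw [← hN]
    calc ε / (2 * (N + 1)) * N + ε / (2 * (N + 1)) * N = ε * (N / (N + 1)) := by field_simp; ring
      _ ≤ ε * 1 := by gcongr; exact div_le_one_of_le₀ (by linarith) (by positivity)
      _ = ε := mul_one _
  have hzero : ((e * (Y - Y') : H →L[ℂ] H) : H →ₗ[ℂ] H) = 0 := (inner_map_self_eq_zero _).1 hform
  have hYw : Y η = w := LinearPMap.mem_graph_snd_inj _ (by simpa [hη] using hY η) hw rfl
  have hYw' : Y' η = w' := LinearPMap.mem_graph_snd_inj _ (by simpa [hη] using hY' η) hw' rfl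
  have := congr($hzero η)
  rw [← hYw, ← hYw']
  exact this

/-- The bilateral almost uniform limit in `L₀⁺` is unique. If `e (y - y') e = 0` for projections
`e = eₙ` tending to `1`, and `f` lies below all `eₙ`, then `eₙ (y - y') f = 0` for all `n`, so `y`
and `y'` agree on the range of `f`. -/
lemma TendstoBAU.unique (hτ : IsNSFTrace M τ) {u : ℕ → H →ₗ.[ℂ] H} {y y' : H →ₗ.[ℂ] H}
    (hu : HoldsOnLarge M τ fun e => ∀ n, BoundedOn M (u n) e)
    (hy : y ∈ L0Pos M τ) (hy' : y' ∈ L0Pos M τ)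
    (h : TendstoBAU M τ u y) (h' : TendstoBAU M τ u y') : y = y' := by
  have hherB : ∀ x : H →ₗ.[ℂ] H, IsHereditary M (BoundedOn M x) := isHereditary_boundedOn
  have hherF : ∀ y, IsHereditary M (FormTendsto u y) := isHereditary_formTendsto u
  have hherU : IsHereditary M fun e => ∀ n, BoundedOn M (u n) e :=
    IsHereditary.forall fun n => hherB (u n)
  have hB := (holdsOnLarge_boundedOn hy.1).and hτ (holdsOnLarge_boundedOn hy'.1)
    (hherB y) (hherB y')
  have hF := h.holdsOnLarge.and hτ h'.holdsOnLarge (hherF y) (hherF y')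
  have hBF := hB.and hτ hF ((hherB y).and (hherB y')) ((hherF y).and (hherF y'))
  have hall := hu.and hτ hBF hherU (((hherB y).and (hherB y')).and ((hherF y).and (hherF y')))
  set Q : (H →L[ℂ] H) → Prop := fun e => ∀ η w w', e η = η → (η, w) ∈ y.graph →
    (η, w') ∈ y'.graph → e (w - w') = 0 with hQ
  have hQlarge : HoldsOnLarge M τ Q := hall.mono fun e _ he ⟨hu, ⟨hy, hy'⟩, h, h'⟩ η w w' =>
    FormTendsto.apply_sub_eq_zero he hu hy hy' h h'
  set R : ℕ → (H →L[ℂ] H) → Prop := fun n f =>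
    ∃ e, IsLargeProj M τ (1 / ((n : ℝ) + 1)) e ∧ Q e ∧ e * f = f with hR
  have hRlarge : HoldsOnLarge M τ fun f => ∀ n, R n f := by
    refine HoldsOnLarge.forall hτ (fun n ε hε => ?_) fun n f g _ hfg ⟨e, he, hQe, hef⟩ => ?_
    · obtain ⟨e, he, hQe⟩ := hQlarge (min ε (1 / ((n : ℝ) + 1))) (by positivity)
      exact ⟨e, ⟨he.1, he.2.1, he.2.2.trans (ENNReal.ofReal_le_ofReal (min_le_left _ _))⟩, e,
        ⟨he.1, he.2.1, he.2.2.trans (ENNReal.ofReal_le_ofReal (min_le_right _ _))⟩, hQe,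
        he.2.1.isIdempotentElem.eq⟩
    · exact ⟨e, he, hQe, by rw [← hfg, ← mul_assoc, hef]⟩
  have hRher : IsHereditary M fun f => ∀ n, R n f :=
    IsHereditary.forall fun n f g _ hfg ⟨e, he, hQe, hef⟩ =>
      ⟨e, he, hQe, by rw [← hfg, ← mul_assoc, hef]⟩
  refine eq_of_holdsOnLarge hτ hy hy' ((hRlarge.and hτ hB hRher ((hherB y).and (hherB y'))).mono ?_)
  rintro f - - ⟨hRf, ⟨Y, -, hY⟩, ⟨Y', -, hY'⟩⟩ η hη
  choose e he hQe hef using hRf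
  have hw : (η, Y η) ∈ y.graph := by simpa [hη] using hY η
  have hw' : (η, Y' η) ∈ y'.graph := by simpa [hη] using hY' η
  have hsub : Y η - Y' η = 0 := by
    refine eq_zero_of_forall_apply_eq_zero hτ he fun n => hQe n η _ _ ?_ hw hw'
    conv_lhs => rw [← hη]
    exact (congr($(hef n) η) : e n (f η) = f η).trans hη
  refine ⟨Y η, hw, ?_⟩
  rwa [sub_eq_zero.1 hsub]

end Uniqueness

/-! ### Averages along geometric sequences -/

/-- Averages of nonnegative numbers are comparable up to the factor `r` at times of ratio at most
`r`, because the sums increase with time. -/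
lemma average_le_mul_average {q : ℕ → ℝ} (hq : ∀ k, 0 ≤ q k) {r s t : ℝ} (hs : 0 < s)
    (hst : s ≤ t) (htr : t ≤ r * s) :
    s⁻¹ * ∑ k ∈ Finset.range ⌊s⌋₊, q k ≤ r * (t⁻¹ * ∑ k ∈ Finset.range ⌊t⌋₊, q k) := by
  have ht : 0 < t := hs.trans_le hst
  have h1 : ∑ k ∈ Finset.range ⌊s⌋₊, q k ≤ ∑ k ∈ Finset.range ⌊t⌋₊, q k :=
    Finset.sum_le_sum_of_subset_of_nonneg
      (Finset.range_subset_range.2 (Nat.floor_le_floor hst)) fun k _ _ => hq k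
  have h2 : s⁻¹ ≤ r * t⁻¹ := by
    rw [← div_eq_mul_inv, le_div_iff₀ ht, inv_mul_le_iff₀ hs]; linarith
  rw [← mul_assoc]
  exact mul_le_mul h2 h1 (Finset.sum_nonneg fun k _ => hq k) ((inv_pos.2 hs).le.trans h2)

section Averages

variable {H : Type*} [NormedAddCommGroup H] [InnerProductSpace ℂ H] [CompleteSpace H]
  {M : VonNeumannAlgebra H} {τ : (H →L[ℂ] H) → ℝ≥0∞}

lemma smul_sum_mem {Z : ℕ → H →L[ℂ] H} (hZ : ∀ k, Z k ∈ M) (c : ℂ) (n : ℕ) :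
    c • ∑ k ∈ Finset.range n, Z k ∈ M :=
  M.toStarSubalgebra.smul_mem (sum_mem fun k _ => hZ k : ∑ k ∈ Finset.range n, Z k ∈ M) c

lemma boundedOn_average {x : ℕ → H →ₗ.[ℂ] H} {e : H →L[ℂ] H} (h : ∀ k, BoundedOn M (x k) e)
    (t : ℝ) : BoundedOn M (average x t) e := by
  choose Z hZ hxZ using h
  refine ⟨((t⁻¹ : ℝ) : ℂ) • ∑ k ∈ Finset.range ⌊t⌋₊, Z k, smul_sum_mem hZ _ _, fun ξ => ?_⟩
  simpa using mem_graph_average t fun k => hxZ k ξ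

lemma inner_average {E : Type*} [NormedAddCommGroup E] [InnerProductSpace ℂ E] (v : ℕ → E)
    (η : E) (t : ℝ) (n : ℕ) (him : ∀ k, (inner ℂ (v k) η).im = 0) :
    inner ℂ (((t⁻¹ : ℝ) : ℂ) • ∑ k ∈ Finset.range n, v k) η =
      ((t⁻¹ * ∑ k ∈ Finset.range n, (inner ℂ (v k) η).re : ℝ) : ℂ) := by
  rw [inner_smul_left, Complex.conj_ofReal, sum_inner, Complex.ofReal_mul, Complex.ofReal_sum]
  congr 1
  exact Finset.sum_congr rfl fun k _ => Complex.ext (by simp) (by simpa using him k)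

/-- Convergence of the averages along `ρ_jᵐ` for all `j`, with `ρ_j → 1`, gives convergence along
all integers: for `ρᵐ ≤ n < ρᵐ⁺¹` the form of `A_n` lies between `ρ⁻¹` times that of `A_{ρᵐ}` and
`ρ` times that of `A_{ρᵐ⁺¹}`, and the form of `y` is bounded on the range of `e`. -/
lemma formTendsto_average {x : ℕ → H →ₗ.[ℂ] H} (hx : ∀ k, x k ∈ L0Pos M τ) {y : H →ₗ.[ℂ] H}
    (hy : y ∈ L0Pos M τ) {e : H →L[ℂ] H} (hxe : ∀ k, BoundedOn M (x k) e) (hye : BoundedOn M y e)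
    {ρ : ℕ → ℝ} (hρ_gt : ∀ j, 1 < ρ j) (hρ_lim : Tendsto ρ atTop (𝓝 1))
    (h : ∀ j, FormTendsto (fun m : ℕ => average x (ρ j ^ m)) y e) :
    FormTendsto (fun n : ℕ => average x (n : ℝ)) y e := by
  choose Z hZ hxZ using hxe
  obtain ⟨Y, -, hY⟩ := hye
  intro δ hδ
  set K := ‖Y‖ with hK
  have hK0 : 0 ≤ K := norm_nonneg _
  -- Choose `r = ρ j` with `(r - 1) K + r δ / 4 ≤ δ`.
  have hη : 0 < min 1 (δ / (2 * (K + 1))) := by positivity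
  obtain ⟨j, hj⟩ := (hρ_lim.eventually_lt_const (lt_add_of_pos_right 1 hη)).exists
  set r := ρ j with hr
  have hr1 : 1 < r := hρ_gt j
  have hr2 : r ≤ 2 := by linarith [min_le_left 1 (δ / (2 * (K + 1)))]
  have hrK : (r - 1) * K ≤ δ / 2 := by
    have h1 : r - 1 ≤ δ / (2 * (K + 1)) := by linarith [min_le_right 1 (δ / (2 * (K + 1)))]
    calc (r - 1) * K ≤ δ / (2 * (K + 1)) * (K + 1) := by gcongr; linarith
      _ = δ / 2 := by field_simp
  obtain ⟨m₀, hm₀⟩ := eventually_atTop.1 (h j (δ / 4) (by positivity))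
  filter_upwards [eventually_ge_atTop (max 1 ⌈r ^ m₀⌉₊)] with n hn η hηe v w hv hw
  have hn1 : (1 : ℝ) ≤ n := by exact_mod_cast (le_max_left _ _).trans hn
  have hnr : r ^ m₀ ≤ n := (Nat.le_ceil _).trans (by exact_mod_cast (le_max_right _ _).trans hn)
  obtain ⟨m, hm, hm'⟩ := exists_nat_pow_near hn1 hr1
  have hmm : m₀ ≤ m := by
    have : r ^ m₀ < r ^ (m + 1) := hnr.trans_lt hm'
    exact Nat.lt_succ_iff.1 ((pow_lt_pow_iff_right₀ hr1).1 this)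
  have hxη : ∀ k, (η, Z k η) ∈ (x k).graph := fun k => by simpa [hηe] using hxZ k η
  have hyη : (η, Y η) ∈ y.graph := by simpa [hηe] using hY η
  set q : ℕ → ℝ := fun k => (inner ℂ (Z k η) η).re with hq
  have hq0 : ∀ k, 0 ≤ q k := fun k => (L0Pos.inner_graph (hx k) (hxη k)).1
  have hqim : ∀ k, (inner ℂ (Z k η) η).im = 0 := fun k => (L0Pos.inner_graph (hx k) (hxη k)).2
  set a : ℝ → ℝ := fun t => t⁻¹ * ∑ k ∈ Finset.range ⌊t⌋₊, q k with ha
  set b := (inner ℂ w η).re with hb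
  have hwb : inner ℂ w η = (b : ℂ) :=
    Complex.ext (by simp [hb]) (by simpa using (L0Pos.inner_graph hy hw).2)
  have hbK : b ≤ K * ‖η‖ ^ 2 := by
    have hwY : w = Y η := LinearPMap.mem_graph_snd_inj _ hw hyη rfl
    calc b ≤ ‖inner ℂ w η‖ := (le_abs_self _).trans (Complex.abs_re_le_norm _)
      _ ≤ ‖w‖ * ‖η‖ := norm_inner_le_norm _ _
      _ ≤ K * ‖η‖ * ‖η‖ := by rw [hwY]; gcongr; exact Y.le_opNorm η
      _ = K * ‖η‖ ^ 2 := by ring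
  have hform : ∀ t v, (η, v) ∈ (average x t).graph →
      ‖inner ℂ (v - w) η‖ = |a t - b| := by
    intro t v hv
    have hvt := LinearPMap.mem_graph_snd_inj _ hv (mem_graph_average t hxη) rfl
    rw [hvt, inner_sub_left, inner_average _ _ _ _ hqim, hwb, ← Complex.ofReal_sub,
      Complex.norm_real, Real.norm_eq_abs]
  have hclose : ∀ i, m₀ ≤ i → |a (r ^ i) - b| ≤ δ / 4 * ‖η‖ ^ 2 := by
    intro i hi
    rw [← hform _ _ (mem_graph_average (r ^ i) hxη)]
    exact hm₀ i hi η hηe _ _ (mem_graph_average (r ^ i) hxη) hw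
  have hlow : a (r ^ m) ≤ r * a n :=
    average_le_mul_average hq0 (by positivity) hm (by rw [← pow_succ']; exact hm'.le)
  have hup : a n ≤ r * a (r ^ (m + 1)) :=
    average_le_mul_average hq0 (by linarith) hm'.le (by rw [pow_succ']; gcongr)
  have h1 := abs_le.1 (hclose m hmm)
  have h2 := abs_le.1 (hclose (m + 1) (by omega))
  rw [hform _ v hv]
  set N := ‖η‖ ^ 2 with hN
  have hN0 : 0 ≤ N := sq_nonneg _
  have hrb : (r - 1) * b ≤ δ / 2 * N :=
    calc (r - 1) * b ≤ (r - 1) * (K * N) := by gcongr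
      _ = (r - 1) * K * N := by ring
      _ ≤ δ / 2 * N := by gcongr
  have hδN : 0 ≤ δ * N := by positivity
  rw [abs_le]
  constructor
  · have h3 : r * (b - a n) ≤ r * (δ * N) := by nlinarith
    linarith [le_of_mul_le_mul_left h3 (by linarith)]
  · have h3 : r * a (r ^ (m + 1)) ≤ r * (b + δ / 4 * N) := by gcongr; linarith
    have h4 : r * (δ / 4 * N) ≤ 2 * (δ / 4 * N) := by gcongr
    nlinarith

lemma FormTendsto.tendsto_normInf_average {x : ℕ → H →ₗ.[ℂ] H} (hx : ∀ k, x k ∈ L0Pos M τ)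
    {y : H →ₗ.[ℂ] H} (hy : y ∈ L0Pos M τ) {e : H →L[ℂ] H} (heM : e ∈ M) (he : IsStarProjection e)
    (hxe : ∀ k, BoundedOn M (x k) e) (hye : BoundedOn M y e) {t : ℕ → ℝ}
    (h : FormTendsto (fun n => average x (t n)) y e) :
    Tendsto (fun n => normInf M (compress e (closedSub (average x (t n)) y))) atTop (𝓝 0) := by
  choose Z hZ hxZ using hxe
  obtain ⟨Y, hYM, hY⟩ := hye
  refine h.tendsto_normInf heM he
    (X := fun n => (((t n)⁻¹ : ℝ) : ℂ) • ∑ k ∈ Finset.range ⌊t n⌋₊, Z k)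
    (fun n => smul_sum_mem hZ _ _) hYM (fun n ξ => ?_) hY (fun n ξ => ?_)
    fun ξ => (L0Pos.inner_graph hy (hY ξ)).2
  · simpa using mem_graph_average (t n) fun k => hxZ k ξ
  · have := inner_average (fun k => Z k ξ) (e ξ) (t n) ⌊t n⌋₊
      fun k => (L0Pos.inner_graph (hx k) (hxZ k ξ)).2
    have h2 := congr($(this).im)
    rw [Complex.ofReal_im] at h2
    simpa using h2

lemma TendstoBAU.comp_tendsto {u : ℕ → H →ₗ.[ℂ] H} {y : H →ₗ.[ℂ] H} (h : TendstoBAU M τ u y)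
    {φ : ℕ → ℕ} (hφ : Tendsto φ atTop atTop) : TendstoBAU M τ (fun n => u (φ n)) y := fun ε hε =>
  let ⟨e, he, hlim⟩ := h ε hε
  ⟨e, he, hlim.comp hφ⟩

end Averages

end NCErgodic

theorem mainTheorem5 {H : Type*} [NormedAddCommGroup H] [InnerProductSpace ℂ H] [CompleteSpace H]
    (M : VonNeumannAlgebra H) (τ : (H →L[ℂ] H) → ℝ≥0∞) (hτ : NCErgodic.IsNSFTrace M τ)
    (x : ℕ → H →ₗ.[ℂ] H) (hx : ∀ k, x k ∈ NCErgodic.L0Pos M τ)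
    (ρ : ℕ → ℝ) (hρ_gt : ∀ j, 1 < ρ j) (hρ_lim : Tendsto ρ atTop (𝓝 1))
    (hρ_sub : ∀ j l, j ≤ l →
      {r : ℝ | ∃ m : ℕ, 1 ≤ m ∧ r = ρ j ^ m} ⊆ {r : ℝ | ∃ m : ℕ, 1 ≤ m ∧ r = ρ l ^ m})
    (y : ℕ → H →ₗ.[ℂ] H) (hy : ∀ j, y j ∈ NCErgodic.L0Pos M τ)
    (hconv : ∀ j, NCErgodic.TendstoBAU M τ
      (fun m : ℕ => NCErgodic.average x (ρ j ^ m)) (y j)) :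
    (∀ j l, y j = y l) ∧
      ∀ j, NCErgodic.TendstoBAU M τ (fun n : ℕ => NCErgodic.average x (n : ℝ)) (y j) := by
  open NCErgodic in
  have hherX : ∀ k, IsHereditary M (BoundedOn M (x k)) := fun k => isHereditary_boundedOn (x k)
  have hX : HoldsOnLarge M τ fun e => ∀ k, BoundedOn M (x k) e :=
    HoldsOnLarge.forall hτ (fun k => holdsOnLarge_boundedOn (hx k).1) hherX
  have heq : ∀ j l, j ≤ l → y j = y l := by
    intro j l hjl
    -- `ρ j = ρ l ^ p`, so the averages along `ρ j ^ m` are a subsequence of those along `ρ l ^ m`.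
    obtain ⟨p, hp, hρp⟩ := hρ_sub j l hjl ⟨1, le_rfl, (pow_one _).symm⟩
    have hsub := (hconv l).comp_tendsto (φ := fun m => p * m)
      (tendsto_id.const_mul_atTop' hp)
    simp only [pow_mul, ← hρp] at hsub
    exact TendstoBAU.unique hτ (hX.mono fun e _ _ h m => boundedOn_average h _)
      (hy j) (hy l) (hconv j) hsub
  have heq' : ∀ j l, y j = y l := fun j l =>
    (le_total j l).elim (heq j l) fun h => (heq l j h).symm
  refine ⟨heq', fun j => ?_⟩
  have hF : HoldsOnLarge M τ fun e => ∀ i, FormTendsto (fun m : ℕ => average x (ρ i ^ m)) (y j) e :=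
    HoldsOnLarge.forall hτ (fun i => by rw [heq' j i]; exact (hconv i).holdsOnLarge)
      fun i => isHereditary_formTendsto _ _
  have hherF : IsHereditary M fun e =>
      ∀ i, FormTendsto (fun m : ℕ => average x (ρ i ^ m)) (y j) e :=
    IsHereditary.forall fun i => isHereditary_formTendsto _ _
  have hYF := (holdsOnLarge_boundedOn (hy j).1).and hτ hF (isHereditary_boundedOn _) hherF
  intro ε hε
  obtain ⟨e, he, hxe, hye, hFe⟩ := hX.and hτ hYF (IsHereditary.forall hherX)
    ((isHereditary_boundedOn _).and hherF) ε hε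
  exact ⟨e, he, FormTendsto.tendsto_normInf_average hx (hy j) he.1 he.2.1 hxe hye
    (formTendsto_average hx (hy j) hxe hye hρ_gt hρ_lim hFe)⟩
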